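/- Let $n,m,p$ be nonnegative integers and let $A\in\mathbb R^{n\times n}$, $B\in\mathbb R^{n\times m}$, $C\in\mathbb R^{p\times n}$, where $A$ is stable, i.e. every complex eigenvalue of $A$ has negative real part. Write $\overline\sigma(M)$ for the maximum singular value of a matrix $M$. For the system $G(s)=C(sI-A)^{-1}B$ of order $n$ define the Kreiss system norm $$\mathcal K(G)=\sup_{\operatorname{Re}(s)>0}\operatorname{Re}(s)\,\overline\sigma\bigl(C(sI-A)^{-1}B\bigr)$$ (the supremum is over complex $s$) and the worst-case transient peak norm $$\mathcal M_0(G)=\sup_{t\ge 0}\overline\sigma\bigl(Ce^{At}B\bigr).$$ Then both suprema are finite and $$\mathcal K(G)\le \mathcal M_0(G)\le e\,n\,\mathcal K(G),$$ where $e=\exp(1)$. -/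

import Mathlib

open scoped Matrix

noncomputable section

namespace KreissSystem

/-- The maximum singular value `σ̄(M)` of a real or complex matrix, i.e. the first (largest) singular
value of `x ↦ M x` between Euclidean spaces. -/
def maxSingularValue {𝕜 : Type*} [RCLike 𝕜] {p m : ℕ} (M : Matrix (Fin p) (Fin m) 𝕜) : ℝ :=
  (Matrix.toEuclideanLin M).singularValues 0

/-- A real matrix is stable (Hurwitz) if all its complex eigenvalues have negative real part. -/
def IsStable {n : ℕ} (A : Matrix (Fin n) (Fin n) ℝ) : Prop :=
  ∀ μ ∈ spectrum ℂ (A.map Complex.ofReal), μ.re < 0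

/-- The transfer function `G(s) = C (s I - A)⁻¹ B` of the system `(A, B, C)`. -/
def transferFunction {n m p : ℕ} (A : Matrix (Fin n) (Fin n) ℝ) (B : Matrix (Fin n) (Fin m) ℝ)
    (C : Matrix (Fin p) (Fin n) ℝ) (s : ℂ) : Matrix (Fin p) (Fin m) ℂ :=
  C.map Complex.ofReal * (s • (1 : Matrix (Fin n) (Fin n) ℂ) - A.map Complex.ofReal)⁻¹ *
    B.map Complex.ofReal

/-- The impulse response `G(t) = C e^{At} B` of the system `(A, B, C)`. -/
def impulseResponse {n m p : ℕ} (A : Matrix (Fin n) (Fin n) ℝ) (B : Matrix (Fin n) (Fin m) ℝ)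
    (C : Matrix (Fin p) (Fin n) ℝ) (t : ℝ) : Matrix (Fin p) (Fin m) ℝ :=
  C * NormedSpace.exp (t • A) * B

/-- The values `Re(s) σ̄(C (s I - A)⁻¹ B)`, `Re(s) > 0`. -/
def kreissValues {n m p : ℕ} (A : Matrix (Fin n) (Fin n) ℝ) (B : Matrix (Fin n) (Fin m) ℝ)
    (C : Matrix (Fin p) (Fin n) ℝ) : Set ℝ :=
  (fun s : ℂ => s.re * maxSingularValue (transferFunction A B C s)) '' {s : ℂ | 0 < s.re}

/-- The values `σ̄(C e^{At} B)`, `t ≥ 0`. -/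
def transientValues {n m p : ℕ} (A : Matrix (Fin n) (Fin n) ℝ) (B : Matrix (Fin n) (Fin m) ℝ)
    (C : Matrix (Fin p) (Fin n) ℝ) : Set ℝ :=
  (fun t : ℝ => maxSingularValue (impulseResponse A B C t)) '' {t : ℝ | 0 ≤ t}

/-- The Kreiss system norm `𝒦(G) = sup_{Re(s) > 0} Re(s) σ̄(C (s I - A)⁻¹ B)`. -/
def kreissNorm {n m p : ℕ} (A : Matrix (Fin n) (Fin n) ℝ) (B : Matrix (Fin n) (Fin m) ℝ)
    (C : Matrix (Fin p) (Fin n) ℝ) : ℝ :=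
  sSup (kreissValues A B C)

/-- The worst-case transient peak norm `ℳ₀(G) = sup_{t ≥ 0} σ̄(C e^{At} B)`. -/
def transientPeak {n m p : ℕ} (A : Matrix (Fin n) (Fin n) ℝ) (B : Matrix (Fin n) (Fin m) ℝ)
    (C : Matrix (Fin p) (Fin n) ℝ) : ℝ :=
  sSup (transientValues A B C)

open scoped Matrix.Norms.L2Operator in
/-- The maximum singular value is the operator norm induced by the Euclidean norms. -/
theorem maxSingularValue_eq_l2_opNorm {𝕜 : Type*} [RCLike 𝕜] {p m : ℕ}
    (M : Matrix (Fin p) (Fin m) 𝕜) : maxSingularValue M = ‖M‖ := by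
  rw [Matrix.l2_opNorm_def, maxSingularValue]
  set T := Matrix.toEuclideanLin M with hT
  have hn : Module.finrank 𝕜 (EuclideanSpace 𝕜 (Fin m)) = m := by simp
  have hS := T.isSymmetric_adjoint_comp_self
  have key : ∀ x, ‖T x‖ ^ 2 = ∑ i, hS.eigenvalues hn i * ‖(hS.eigenvectorBasis hn).repr x i‖ ^ 2 := by
    intro x
    have h1 : (‖T x‖ ^ 2 : ℝ) = RCLike.re (inner 𝕜 x ((LinearMap.adjoint T ∘ₗ T) x)) := by
      rw [LinearMap.comp_apply, LinearMap.adjoint_inner_right, inner_self_eq_norm_sq]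
    rw [h1, ← (hS.eigenvectorBasis hn).repr.inner_map_map, PiLp.inner_apply, map_sum]
    refine Finset.sum_congr rfl fun i _ => ?_
    rw [hS.eigenvectorBasis_apply_self_apply hn, RCLike.inner_apply, mul_assoc, RCLike.mul_conj]
    norm_cast
  apply le_antisymm
  · rcases Nat.eq_zero_or_pos m with h0 | h0
    · rw [T.singularValues_of_finrank_le (by simp [h0])]
      exact norm_nonneg _
    · have h2 := key (hS.eigenvectorBasis hn ⟨0, h0⟩)
      rw [Finset.sum_eq_single ⟨0, h0⟩] at h2
      · rw [← T.sq_singularValues_of_lt hn h0] at h2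
        simp at h2
        have h3 := (LinearMap.toContinuousLinearMap T).le_opNorm (hS.eigenvectorBasis hn ⟨0, h0⟩)
        rw [(hS.eigenvectorBasis hn).norm_eq_one, mul_one] at h3
        refine le_trans ?_ h3
        refine le_of_eq ?_
        exact ((sq_eq_sq₀ (norm_nonneg _) (T.singularValues_nonneg 0)).1 h2).symm
      · intro i _ hi
        simp [hi]
      · simp
  · refine ContinuousLinearMap.opNorm_le_bound _ (T.singularValues_nonneg 0) fun x => ?_
    refine le_of_sq_le_sq ?_ (mul_nonneg (T.singularValues_nonneg 0) (norm_nonneg _))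
    change ‖T x‖ ^ 2 ≤ _
    rw [key, mul_pow, ← (hS.eigenvectorBasis hn).repr.norm_map x, EuclideanSpace.norm_sq_eq,
      Finset.mul_sum]
    refine Finset.sum_le_sum fun i _ => mul_le_mul_of_nonneg_right ?_ (sq_nonneg _)
    rw [← T.sq_singularValues_fin hn]
    exact pow_le_pow_left₀ (T.singularValues_nonneg _) (T.singularValues_antitone (Nat.zero_le _)) 2

end KreissSystem

end

/-! Lower bound: `C (sI - A)⁻¹ B` is the Laplace transform of `C e^{tA} B`, and `∫₀^∞ e^{-t Re s} dt
= 1 / Re s`.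

Upper bound: pairing with test vectors reduces it to a scalar `φ(e^{tA}) = wᵀ e^{tA} z` with a
constant independent of the vectors. Put `R(s) = (sI - A)⁻¹` and suppose `Re s * |φ(R(s))| ≤ κ`. The
Laplace transform of `t φ(e^{tA})` is `φ(R²) = -(d/ds) φ(R)`, so Fourier inversion on the line `Re s
= ε` bounds `t e^{-εt} |φ(e^{tA})|` by `1/(2π)` times the length of the curve traced there by
`φ(R)`. This curve is a rational function of degree at most `n` bounded by `κ/ε`, so Spijker's lemma
bounds its length by `2πnκ/ε`. The choice `ε = 1/t` gives `e n κ`.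

Spijker's lemma is integral geometry: a length is an average over directions of the variation of
projections, and a projection of a degree `n` rational curve takes each value, with at most one
exception, at most `2n` times (`exists_encard_level_re_le`, `sum_norm_sub_le_of_rational`).
Finiteness comes from boundedness of a stable semigroup (`exists_norm_exp_smul_le_of_spectrum`). -/

open MeasureTheory Set Filter Topology Polynomial

namespace KreissSystem

/-! ### Spijker's lemma: level counts, projections and arc length -/

open scoped ENNReal in
/-- Banach-indicatrix bound: if a continuous function bounded by `M` takes all but one value at most
`N` times, then its variation along disjoint intervals is at most `2 M N`. -/
theorem sum_abs_sub_le_of_encard_level_le {ι : Type*} (s : Finset ι) {f : ℝ → ℝ} (hf : Continuous f)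
    {M : ℝ} (hM : ∀ x, |f x| ≤ M) {N : ℕ} {y₀ : ℝ}
    (hN : ∀ y, y ≠ y₀ → {x | f x = y}.encard ≤ N) (a b : ι → ℝ) (hab : ∀ i ∈ s, a i ≤ b i)
    (hd : (s : Set ι).PairwiseDisjoint fun i => Ioo (a i) (b i)) :
    ∑ i ∈ s, |f (b i) - f (a i)| ≤ N * (2 * M) := by
  classical
  have hM0 : 0 ≤ M := (abs_nonneg _).trans (hM 0)
  set U : ι → Set ℝ := fun i => Ioo (min (f (a i)) (f (b i))) (max (f (a i)) (f (b i))) with hU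
  have hvol : ∀ i, ENNReal.ofReal |f (b i) - f (a i)| = ∫⁻ y, (U i).indicator 1 y := by
    intro i
    rw [lintegral_indicator_one measurableSet_Ioo, Real.volume_Ioo, max_sub_min_eq_abs]
  have hcross : ∀ i ∈ s, ∀ y ∈ U i, ∃ c ∈ Ioo (a i) (b i), f c = y := by
    intro i hi y hy
    rcases le_total (f (a i)) (f (b i)) with h | h
    · simp only [hU, min_eq_left h, max_eq_right h] at hy
      exact intermediate_value_Ioo (hab i hi) hf.continuousOn hy
    · simp only [hU, min_eq_right h, max_eq_left h] at hy
      exact intermediate_value_Ioo' (hab i hi) hf.continuousOn hy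
  -- The intervals whose endpoint values straddle `y` each contain a preimage of `y`. Disjointness
  -- makes these preimages distinct, so at most `N` intervals count. The excluded level is a null
  -- set.
  have hpt : ∀ y, y ≠ y₀ →
      ∑ i ∈ s, (U i).indicator (1 : ℝ → ℝ≥0∞) y ≤ (Icc (-M) M).indicator (fun _ => (N : ℝ≥0∞)) y := by
    intro y hy
    have hsum : ∑ i ∈ s, (U i).indicator (1 : ℝ → ℝ≥0∞) y = ((s.filter fun i => y ∈ U i).card : ℝ≥0∞) := by
      rw [Finset.card_filter, Nat.cast_sum]
      exact Finset.sum_congr rfl fun i _ => by simp [indicator_apply]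
    rw [hsum]
    choose! c hc hfc using hcross
    have hinj : ∀ i ∈ s.filter (fun i => y ∈ U i), ∀ j ∈ s.filter (fun i => y ∈ U i),
        c i y = c j y → i = j := by
      intro i hi j hj hij
      rw [Finset.mem_filter] at hi hj
      by_contra hne
      have := hd hi.1 hj.1 hne
      exact Set.disjoint_left.1 this (hc i hi.1 y hi.2) (hij ▸ hc j hj.1 y hj.2)
    by_cases hyM : y ∈ Icc (-M) M
    · rw [indicator_of_mem hyM]
      have h1 : ((s.filter fun i => y ∈ U i).image fun i => c i y).card
          = (s.filter fun i => y ∈ U i).card := Finset.card_image_of_injOn hinj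
      have h2 : ((((s.filter fun i => y ∈ U i).image fun i => c i y) : Finset ℝ) : Set ℝ)
          ⊆ {x | f x = y} := by
        intro x hx
        simp only [Finset.coe_image, Set.mem_image, Finset.mem_coe, Finset.mem_filter] at hx
        obtain ⟨i, hi, rfl⟩ := hx
        exact hfc i hi.1 y hi.2
      have h3 := (encard_le_encard h2).trans (hN y hy)
      rw [encard_coe_eq_coe_finsetCard, h1] at h3
      exact_mod_cast h3
    · rw [indicator_of_notMem hyM, Finset.filter_eq_empty_iff.2]
      · simp
      · intro i hi hyi
        apply hyM
        rw [← hfc i hi y hyi]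
        exact abs_le.1 (hM _)
  have hle : ∑ i ∈ s, ENNReal.ofReal |f (b i) - f (a i)| ≤ ENNReal.ofReal (N * (2 * M)) := by
    simp_rw [hvol]
    rw [← lintegral_finsetSum _ fun i _ => measurable_one.indicator measurableSet_Ioo]
    calc _ ≤ ∫⁻ y, (Icc (-M) M).indicator (fun _ => (N : ℝ≥0∞)) y := by
          apply lintegral_mono_ae
          filter_upwards [(Set.countable_singleton y₀).ae_notMem volume] with y hy
          exact hpt y hy
      _ = _ := by
          rw [lintegral_indicator_const measurableSet_Icc, Real.volume_Icc,
            ENNReal.ofReal_mul (by positivity), ENNReal.ofReal_natCast]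
          congr 2; ring
  rw [← ENNReal.ofReal_sum_of_nonneg fun i _ => abs_nonneg _] at hle
  exact (ENNReal.ofReal_le_ofReal_iff (by positivity)).1 hle

theorem integral_abs_cos : ∫ θ in (0 : ℝ)..2 * Real.pi, |Real.cos θ| = 4 := by
  have hper : Function.Periodic (fun θ => |Real.cos θ|) (2 * Real.pi) := fun θ => by
    simp [Real.cos_add_two_pi]
  have h := hper.intervalIntegral_add_eq 0 (-(Real.pi / 2))
  rw [zero_add] at h
  have hi : ∀ a b, IntervalIntegrable (fun θ => |Real.cos θ|) volume a b := fun a b =>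
    (Real.continuous_cos.abs).intervalIntegrable a b
  rw [h, ← intervalIntegral.integral_add_adjacent_intervals (hi _ (Real.pi / 2)) (hi _ _)]
  have h1 : ∫ θ in -(Real.pi / 2)..Real.pi / 2, |Real.cos θ|
      = ∫ θ in -(Real.pi / 2)..Real.pi / 2, Real.cos θ := by
    apply intervalIntegral.integral_congr
    intro θ hθ
    rw [uIcc_of_le (by linarith [Real.pi_pos])] at hθ
    exact abs_of_nonneg (Real.cos_nonneg_of_mem_Icc hθ)
  have h2 : ∫ θ in Real.pi / 2..-(Real.pi / 2) + 2 * Real.pi, |Real.cos θ|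
      = ∫ θ in Real.pi / 2..-(Real.pi / 2) + 2 * Real.pi, -Real.cos θ := by
    apply intervalIntegral.integral_congr
    intro θ hθ
    rw [uIcc_of_le (by linarith [Real.pi_pos])] at hθ
    exact abs_of_nonpos (Real.cos_nonpos_of_pi_div_two_le_of_le hθ.1 (by linarith [hθ.2]))
  rw [h1, h2, intervalIntegral.integral_neg, integral_cos, integral_cos, Real.sin_add_two_pi,
    Real.sin_neg, Real.sin_pi_div_two]
  norm_num

/-- Cauchy's projection formula for the modulus of a complex number. -/
theorem integral_abs_re_exp_mul (z : ℂ) :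
    ∫ θ in (0 : ℝ)..2 * Real.pi, |(Complex.exp (θ * Complex.I) * z).re| = 4 * ‖z‖ := by
  have hz : ∀ θ : ℝ, |(Complex.exp (θ * Complex.I) * z).re| = ‖z‖ * |Real.cos (θ + z.arg)| := by
    intro θ
    conv_lhs => rw [← Complex.norm_mul_exp_arg_mul_I z]
    have : Complex.exp (θ * Complex.I) * (‖z‖ * Complex.exp (z.arg * Complex.I))
        = ((‖z‖ : ℝ) : ℂ) * Complex.exp ((θ + z.arg : ℝ) * Complex.I) := by
      push_cast
      rw [add_mul, Complex.exp_add]; ring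
    rw [this, Complex.re_ofReal_mul, Complex.exp_ofReal_mul_I_re, abs_mul, abs_norm]
  have hper : Function.Periodic (fun θ => |Real.cos θ|) (2 * Real.pi) := fun θ => by
    simp [Real.cos_add_two_pi]
  simp_rw [hz]
  rw [intervalIntegral.integral_const_mul,
    intervalIntegral.integral_comp_add_right (fun θ => |Real.cos θ|), zero_add, add_comm (2 * Real.pi),
    hper.intervalIntegral_add_eq z.arg 0, zero_add, integral_abs_cos, mul_comm]

/-- The real part of a rational function of degree `n` takes all but one value at most `2 n` times on
the real line. -/
theorem exists_encard_level_re_le {n : ℕ} {P Q : ℂ[X]} (hP : P.natDegree ≤ n) (hQ : Q.natDegree ≤ n)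
    (hQ0 : ∀ x : ℝ, Q.eval (x : ℂ) ≠ 0) (w : ℂ) :
    ∃ y₀ : ℝ, ∀ y, y ≠ y₀ →
      {x : ℝ | (w * (P.eval (x : ℂ) / Q.eval (x : ℂ))).re = y}.encard ≤ (2 * n : ℕ) := by
  set conjP : ℂ[X] → ℂ[X] := fun p => p.map (starRingEnd ℂ) with hconj
  have hev : ∀ (p : ℂ[X]) (x : ℝ), (conjP p).eval (x : ℂ) = starRingEnd ℂ (p.eval (x : ℂ)) := by
    intro p x
    simp only [hconj]
    rw [eval_map, ← Complex.conj_ofReal x, eval₂_at_apply, Complex.conj_ofReal]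
  -- For real `x`, this is `Re (w P/Q) - y` with denominators cleared by `2 |Q|²`. Conjugating
  -- coefficients keeps it polynomial, of degree at most `2n`.
  set T : ℝ → ℂ[X] := fun y => C w * (P * conjP Q) + C (starRingEnd ℂ w) * (conjP P * Q)
    - C (2 * (y : ℂ)) * (Q * conjP Q) with hT
  have hdegconj : ∀ p : ℂ[X], (conjP p).natDegree = p.natDegree := fun p =>
    natDegree_map (starRingEnd ℂ)
  have hdeg : ∀ y, (T y).natDegree ≤ 2 * n := by
    intro y
    have hmul : ∀ (c : ℂ) (p q : ℂ[X]), p.natDegree ≤ n → q.natDegree ≤ n →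
        (C c * (p * q)).natDegree ≤ 2 * n := by
      intro c p q hp hq
      refine (natDegree_C_mul_le _ _).trans (natDegree_mul_le.trans ?_)
      omega
    have hP' : (conjP P).natDegree ≤ n := (hdegconj P).trans_le hP
    have hQ' : (conjP Q).natDegree ≤ n := (hdegconj Q).trans_le hQ
    exact (natDegree_sub_le _ _).trans (max_le (natDegree_add_le_of_degree_le
      (hmul _ _ _ hP hQ') (hmul _ _ _ hP' hQ)) (hmul _ _ _ hQ hQ'))
  have hroot : ∀ y x : ℝ, (T y).eval (x : ℂ) = 0 ↔
      (w * (P.eval (x : ℂ) / Q.eval (x : ℂ))).re = y := by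
    intro y x
    have hq := hQ0 x
    have hq' : starRingEnd ℂ (Q.eval (x : ℂ)) ≠ 0 := by simpa using hq
    simp only [hT, eval_sub, eval_add, eval_mul, eval_C, hev]
    set p := P.eval (x : ℂ)
    set q := Q.eval (x : ℂ)
    have hre : ((2 * (w * (p / q)).re : ℝ) : ℂ)
        = w * (p / q) + starRingEnd ℂ w * (starRingEnd ℂ p / starRingEnd ℂ q) := by
      have := Complex.add_conj (w * (p / q))
      rw [← this]; simp
    have : w * (p * starRingEnd ℂ q) + starRingEnd ℂ w * (starRingEnd ℂ p * q)
        - 2 * (y : ℂ) * (q * starRingEnd ℂ q)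
        = (((2 * (w * (p / q)).re : ℝ) : ℂ) - 2 * (y : ℂ)) * (q * starRingEnd ℂ q) := by
      rw [hre]; field_simp
    rw [this, mul_eq_zero, or_iff_left (mul_ne_zero hq hq'), sub_eq_zero]
    norm_cast
    constructor <;> intro h <;> linarith
  -- If some `T y₀` vanishes identically, the real part is constantly `y₀` and every other level is
  -- empty; this is the only source of an exceptional value.
  by_cases h0 : ∃ y, T y = 0
  · obtain ⟨y₀, hy₀⟩ := h0
    refine ⟨y₀, fun y hy => ?_⟩
    have : {x : ℝ | (w * (P.eval (x : ℂ) / Q.eval (x : ℂ))).re = y} = ∅ := by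
      refine eq_empty_of_forall_notMem fun x hx => hy ?_
      rw [← show _ = y from hx]
      exact (hroot y₀ x).1 (by simp [hy₀])
    rw [this, encard_empty]
    exact zero_le
  · push Not at h0
    refine ⟨0, fun y _ => ?_⟩
    have hsub : (fun x : ℝ => (x : ℂ)) '' {x : ℝ | (w * (P.eval (x : ℂ) / Q.eval (x : ℂ))).re = y}
        ⊆ ((T y).roots.toFinset : Set ℂ) := by
      rintro _ ⟨x, hx, rfl⟩
      simpa [h0 y] using (hroot y x).2 hx
    rw [← Complex.ofReal_injective.encard_image]
    refine (encard_le_encard hsub).trans ?_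
    rw [encard_coe_eq_coe_finsetCard]
    exact_mod_cast ((Multiset.toFinset_card_le _).trans (card_roots' _)).trans (hdeg y)

/-- **Spijker's lemma**, chord form. -/
theorem sum_norm_sub_le_of_rational {n : ℕ} {P Q : ℂ[X]} (hP : P.natDegree ≤ n)
    (hQ : Q.natDegree ≤ n) (hQ0 : ∀ x : ℝ, Q.eval (x : ℂ) ≠ 0) {q : ℝ → ℂ}
    (hq : ∀ x : ℝ, q x = P.eval (x : ℂ) / Q.eval (x : ℂ)) {M : ℝ} (hM : ∀ x, ‖q x‖ ≤ M)
    {ι : Type*} (s : Finset ι) (a b : ι → ℝ) (hab : ∀ i ∈ s, a i ≤ b i)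
    (hd : (s : Set ι).PairwiseDisjoint fun i => Ioo (a i) (b i)) :
    ∑ i ∈ s, ‖q (b i) - q (a i)‖ ≤ 2 * Real.pi * n * M := by
  have hqc : Continuous q := by
    rw [funext hq]
    exact (P.continuous.comp Complex.continuous_ofReal).div
      (Q.continuous.comp Complex.continuous_ofReal) hQ0
  have hθ : ∀ θ : ℝ, ∑ i ∈ s, |(Complex.exp (θ * Complex.I) * (q (b i) - q (a i))).re|
      ≤ 4 * n * M := by
    intro θ
    obtain ⟨y₀, hy₀⟩ := exists_encard_level_re_le hP hQ hQ0 (Complex.exp (θ * Complex.I))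
    have := sum_abs_sub_le_of_encard_level_le s
      (f := fun x => (Complex.exp (θ * Complex.I) * q x).re) (by fun_prop) (M := M)
      (fun x => (Complex.abs_re_le_norm _).trans (by simpa using hM x)) (N := 2 * n) (y₀ := y₀)
      (by simpa only [hq] using hy₀) a b hab hd
    simp only [mul_sub, Complex.sub_re] at this ⊢
    refine this.trans (le_of_eq ?_)
    push_cast; ring
  have hcont : ∀ i, Continuous fun θ : ℝ =>
      |(Complex.exp (θ * Complex.I) * (q (b i) - q (a i))).re| := by
    intro i; fun_prop
  -- Integrate `hθ` over all directions: Cauchy's formula turns the left side into 4 times the chord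
  -- sum, while the right side gains the factor `2π`.
  have h4 : 4 * ∑ i ∈ s, ‖q (b i) - q (a i)‖ ≤ 4 * (2 * Real.pi * n * M) := by
    rw [Finset.mul_sum]
    simp_rw [← integral_abs_re_exp_mul]
    rw [← intervalIntegral.integral_finsetSum fun i _ => (hcont i).intervalIntegrable _ _]
    refine (intervalIntegral.integral_mono_on (by positivity)
      ((continuous_finsetSum _ fun i _ => hcont i).intervalIntegrable _ _)
      (intervalIntegrable_const (c := 4 * n * M)) fun θ _ => hθ θ).trans (le_of_eq ?_)
    rw [intervalIntegral.integral_const, smul_eq_mul]; ring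
  linarith

/-- The integral of the speed of a curve is bounded by its variation. -/
theorem lintegral_enorm_deriv_le_of_sum_le {E : Type*} [NormedAddCommGroup E] [NormedSpace ℝ E]
    {q q' : ℝ → E} (hq : ∀ x, HasDerivAt q (q' x) x) {V : ℝ}
    (hV : ∀ (s : Finset ℤ) (a b : ℤ → ℝ), (∀ i ∈ s, a i ≤ b i) →
      (s : Set ℤ).PairwiseDisjoint (fun i => Ioo (a i) (b i)) →
      ∑ i ∈ s, ‖q (b i) - q (a i)‖ ≤ V) :
    ∫⁻ x, ‖q' x‖ₑ ≤ ENNReal.ofReal V := by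
  have hqc : Continuous q := continuous_iff_continuousAt.2 fun x => (hq x).continuousAt
  set h : ℕ → ℝ := fun k => 1 / ((k : ℝ) + 1) with hh
  have hpos : ∀ k, 0 < h k := fun k => Nat.one_div_pos_of_nat
  set g : ℕ → ℝ → ENNReal := fun k x => ‖(h k)⁻¹ • (q (x + h k) - q x)‖ₑ with hg
  have hgc : ∀ k, Continuous (g k) := fun k => by
    simp only [hg]; fun_prop
  have hlim : ∀ x, Tendsto (fun k => g k x) atTop (𝓝 ‖q' x‖ₑ) := by
    intro x
    have h1 := (hasDerivAt_iff_tendsto_slope_zero.1 (hq x))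
    have h2 : Tendsto h atTop (𝓝[≠] 0) :=
      tendsto_nhdsWithin_iff.2 ⟨tendsto_one_div_add_atTop_nhds_zero_nat,
        Eventually.of_forall fun k => (hpos k).ne'⟩
    exact (continuous_enorm.tendsto _).comp (h1.comp h2)
  have hbound : ∀ k, ∫⁻ x, g k x ≤ ENNReal.ofReal V := by
    intro k
    -- Fold the line onto one cell of length `h k`. For a fixed offset the difference quotients over
    -- all cells form a chord sum divided by `h k`, hence at most `V / h k`; integrating over the
    -- cell restores `V`.
    have htile : ∫⁻ x, g k x = ∑' j : ℤ, ∫⁻ x in Ioc 0 (h k), g k (x + j * h k) := by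
      have hU : (univ : Set ℝ) = ⋃ j : ℤ, Ioc (0 + j • h k) (0 + (j + 1) • h k) :=
        (iUnion_Ioc_add_zsmul (hpos k) 0).symm
      rw [← setLIntegral_univ, hU, lintegral_iUnion (fun _ => measurableSet_Ioc)
        (pairwise_disjoint_Ioc_add_zsmul 0 (h k))]
      refine tsum_congr fun j => ?_
      have hpre : (fun x => x + j * h k) ⁻¹' Ioc (0 + j • h k) (0 + (j + 1) • h k)
          = Ioc 0 (h k) := by
        ext x
        simp only [mem_preimage, mem_Ioc, zsmul_eq_mul, Int.cast_add, Int.cast_one]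
        constructor <;> rintro ⟨h1, h2⟩ <;> constructor <;> linarith
      rw [← hpre]
      exact ((measurePreserving_add_right volume ((j : ℝ) * h k)).setLIntegral_comp_preimage
        measurableSet_Ioc (hgc k).measurable).symm
    have hgj : ∀ j : ℤ, Continuous fun x => g k (x + j * h k) := fun j =>
      (hgc k).comp (continuous_add_const _)
    rw [htile, ← lintegral_tsum fun j => (hgj j).measurable.aemeasurable]
    have hpt : ∀ x, ∑' j : ℤ, g k (x + j * h k) ≤ ENNReal.ofReal ((h k)⁻¹ * V) := by
      intro x
      rw [ENNReal.tsum_eq_iSup_sum]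
      refine iSup_le fun s => ?_
      have hterm : ∀ j : ℤ, g k (x + j * h k)
          = ENNReal.ofReal ((h k)⁻¹ * ‖q (x + (j + 1) * h k) - q (x + j * h k)‖) := by
        intro j
        simp only [hg]
        rw [← ofReal_norm, norm_smul, Real.norm_of_nonneg (inv_nonneg.2 (hpos k).le)]
        congr 5; ring
      simp_rw [hterm]
      rw [← ENNReal.ofReal_sum_of_nonneg fun j _ =>
        mul_nonneg (inv_nonneg.2 (hpos k).le) (norm_nonneg _), ← Finset.mul_sum]
      refine ENNReal.ofReal_le_ofReal (mul_le_mul_of_nonneg_left ?_ (inv_nonneg.2 (hpos k).le))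
      refine hV s (fun j => x + j * h k) (fun j => x + (j + 1) * h k)
        (fun j _ => by nlinarith [hpos k]) ?_
      have hdis := (pairwise_disjoint_Ioo_add_zsmul x (h k)).set_pairwise (s : Set ℤ)
      simpa [PairwiseDisjoint, Function.onFun, zsmul_eq_mul] using hdis
    refine (lintegral_mono hpt).trans (le_of_eq ?_)
    rw [setLIntegral_const, Real.volume_Ioc, ← ENNReal.ofReal_mul' (by linarith [hpos k])]
    congr 1
    field_simp [(hpos k).ne']
    ring
  -- Fatou's lemma, applied to the difference quotients.
  calc ∫⁻ x, ‖q' x‖ₑ = ∫⁻ x, liminf (fun k => g k x) atTop :=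
        lintegral_congr fun x => (hlim x).liminf_eq.symm
    _ ≤ liminf (fun k => ∫⁻ x, g k x) atTop := lintegral_liminf_le fun k => (hgc k).measurable
    _ ≤ ENNReal.ofReal V := by
        refine (liminf_le_liminf (Eventually.of_forall hbound)).trans ?_
        simp

/-! ### Bounded semigroups and Laplace transforms of the resolvent -/

section BanachAlgebra

variable {𝔸 : Type*} [NormedRing 𝔸] [NormedAlgebra ℂ 𝔸] [CompleteSpace 𝔸]

theorem exp_smul_mul_eq_sum_of_pow_mul_eq_zero {N X : 𝔸} {k : ℕ} (h : N ^ k * X = 0) (c : ℂ) :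
    NormedSpace.exp (c • N) * X
      = ∑ j ∈ Finset.range k, (c ^ j / (j.factorial : ℂ)) • (N ^ j * X) := by
  have h1 := (NormedSpace.exp_series_hasSum_exp' (𝕂 := ℂ) (c • N)).mul_right X
  refine h1.unique ?_
  have h2 : ∀ j, ((j.factorial : ℂ)⁻¹ • (c • N) ^ j) * X
      = (c ^ j / (j.factorial : ℂ)) • (N ^ j * X) := by
    intro j
    rw [_root_.smul_pow, smul_smul, smul_mul_assoc, div_eq_inv_mul]
  simp_rw [h2]
  refine hasSum_sum_of_ne_finset_zero fun j hj => ?_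
  rw [Finset.mem_range, not_lt] at hj
  obtain ⟨d, rfl⟩ := Nat.exists_eq_add_of_le hj
  rw [add_comm, pow_add N, mul_assoc, h, mul_zero, smul_zero]

/-- On a generalized eigenvector the exponential is `e^{tμ}` times a polynomial in `t`. The
inequality `x ^ j / j! ≤ e^x` at `x = -t Re μ` absorbs each power of `t` uniformly. -/
theorem exists_norm_exp_smul_mul_le_of_pow_mul_eq_zero {A X : 𝔸} {μ : ℂ} (hμ : μ.re < 0) {k : ℕ}
    (h : (A - μ • (1 : 𝔸)) ^ k * X = 0) :
    ∃ K : ℝ, ∀ t : ℝ, 0 ≤ t → ‖NormedSpace.exp ((t : ℂ) • A) * X‖ ≤ K := by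
  set N := A - μ • (1 : 𝔸) with hN
  refine ⟨∑ j ∈ Finset.range k, ((-μ.re) ^ j)⁻¹ * ‖N ^ j * X‖, fun t ht => ?_⟩
  let _ : NormedAlgebra ℚ 𝔸 := NormedAlgebra.restrictScalars ℚ ℂ 𝔸
  have hA : (t : ℂ) • A = ((t : ℂ) * μ) • (1 : 𝔸) + (t : ℂ) • N := by
    rw [hN, smul_sub, smul_smul]; abel
  have hc : Commute (((t : ℂ) * μ) • (1 : 𝔸)) ((t : ℂ) • N) :=
    (Commute.one_left _).smul_left _
  have he : NormedSpace.exp (((t : ℂ) * μ) • (1 : 𝔸)) = Complex.exp (t * μ) • (1 : 𝔸) := by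
    rw [← Algebra.algebraMap_eq_smul_one, ← Algebra.algebraMap_eq_smul_one,
      ← NormedSpace.algebraMap_exp_comm, Complex.exp_eq_exp_ℂ]
  rw [hA, NormedSpace.exp_add_of_commute hc, he, mul_assoc,
    exp_smul_mul_eq_sum_of_pow_mul_eq_zero h, smul_mul_assoc, one_mul, norm_smul, Complex.norm_exp]
  refine (mul_le_mul_of_nonneg_left (norm_sum_le _ _) (Real.exp_nonneg _)).trans ?_
  rw [Finset.mul_sum]
  refine Finset.sum_le_sum fun j _ => ?_
  rw [norm_smul, ← mul_assoc]
  refine mul_le_mul_of_nonneg_right ?_ (norm_nonneg _)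
  have hre : ((t : ℂ) * μ).re = -(-μ.re * t) := by simp; ring
  have hx : 0 ≤ -μ.re * t := mul_nonneg (by linarith) ht
  have hp := Real.pow_div_factorial_le_exp _ hx j
  have hpos : 0 < (-μ.re) ^ j := pow_pos (by linarith) j
  rw [norm_div, norm_pow, Complex.norm_real, Real.norm_of_nonneg ht, Complex.norm_natCast, hre,
    Real.exp_neg, inv_mul_le_iff₀ (Real.exp_pos _), ← div_eq_mul_inv, le_div_iff₀ hpos]
  refine le_trans (le_of_eq ?_) hp
  rw [mul_pow]; ring

/-- In a finite-dimensional algebra, the semigroup generated by a stable element is bounded. -/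
theorem exists_norm_exp_smul_le_of_spectrum [FiniteDimensional ℂ 𝔸] {A : 𝔸}
    (hA : ∀ μ ∈ spectrum ℂ A, μ.re < 0) :
    ∃ K : ℝ, ∀ t : ℝ, 0 ≤ t → ‖NormedSpace.exp ((t : ℂ) • A)‖ ≤ K := by
  -- The elements with bounded orbit form a subspace. It contains every generalized eigenspace of
  -- left multiplication by `A`; these span, so it contains `1`.
  let S : Submodule ℂ 𝔸 :=
    { carrier := {X | ∃ K : ℝ, ∀ t : ℝ, 0 ≤ t → ‖NormedSpace.exp ((t : ℂ) • A) * X‖ ≤ K}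
      zero_mem' := ⟨0, fun t _ => by simp⟩
      add_mem' := by
        rintro X Y ⟨K, hK⟩ ⟨L, hL⟩
        refine ⟨K + L, fun t ht => ?_⟩
        rw [mul_add]
        exact (norm_add_le _ _).trans (add_le_add (hK t ht) (hL t ht))
      smul_mem' := by
        rintro c X ⟨K, hK⟩
        refine ⟨‖c‖ * K, fun t ht => ?_⟩
        rw [mul_smul_comm, norm_smul]
        exact mul_le_mul_of_nonneg_left (hK t ht) (norm_nonneg _) }
  have hpow : ∀ (μ : ℂ) (k : ℕ) (X : 𝔸),
      ((LinearMap.mulLeft ℂ A - μ • (1 : Module.End ℂ 𝔸)) ^ k) X = (A - μ • (1 : 𝔸)) ^ k * X := by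
    intro μ k X
    have : LinearMap.mulLeft ℂ A - μ • (1 : Module.End ℂ 𝔸)
        = LinearMap.mulLeft ℂ (A - μ • (1 : 𝔸)) := by
      ext Y; simp [sub_mul]
    rw [this, LinearMap.pow_mulLeft, LinearMap.mulLeft_apply]
  have htop : S = ⊤ := by
    rw [eq_top_iff, ← Module.End.iSup_maxGenEigenspace_eq_top (LinearMap.mulLeft ℂ A)]
    refine iSup_le fun μ X hX => ?_
    obtain ⟨k, hk⟩ := (Module.End.mem_maxGenEigenspace _ _ _).1 hX
    by_cases hμ : μ ∈ spectrum ℂ A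
    · exact exists_norm_exp_smul_mul_le_of_pow_mul_eq_zero (hA μ hμ) (by rw [← hpow, hk])
    · have hu : IsUnit (A - μ • (1 : 𝔸)) := by
        rw [spectrum.notMem_iff, Algebra.algebraMap_eq_smul_one] at hμ
        rw [← neg_sub]; exact hμ.neg
      have h0 : X = 0 := by
        rw [hpow] at hk
        exact (hu.pow k).mul_right_eq_zero.1 hk
      rw [h0]; exact S.zero_mem
  have h1 : (1 : 𝔸) ∈ S := htop ▸ Submodule.mem_top
  simpa [S] using h1

variable {A : 𝔸} {K : ℝ} (φ : 𝔸 →L[ℂ] ℂ)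

/-- Supplies explicit antiderivatives: when `(s - A) Y` is `1` or `R`, the Laplace integrals reduce
to boundary terms. -/
theorem hasDerivAt_exp_mul_apply_exp_smul_mul (s : ℂ) (Y : 𝔸) (t : ℝ) :
    HasDerivAt (fun t : ℝ => Complex.exp (-s * t) * φ (NormedSpace.exp ((t : ℂ) • A) * Y))
      (-(Complex.exp (-s * t) * φ (NormedSpace.exp ((t : ℂ) • A) * ((s • 1 - A) * Y)))) t := by
  have h1 : HasDerivAt (fun z : ℂ => Complex.exp (-s * z)) (Complex.exp (-s * t) * -s) (t : ℂ) := by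
    simpa using ((hasDerivAt_id (t : ℂ)).const_mul (-s)).cexp
  have h2 := φ.hasFDerivAt.comp_hasDerivAt (t : ℂ)
    ((hasDerivAt_exp_smul_const (𝕂 := ℂ) A (t : ℂ)).mul_const Y)
  have h3 := (h1.mul h2).comp_ofReal
  refine h3.congr_deriv ?_
  have : NormedSpace.exp ((t : ℂ) • A) * ((s • 1 - A) * Y)
      = s • (NormedSpace.exp ((t : ℂ) • A) * Y) - NormedSpace.exp ((t : ℂ) • A) * A * Y := by
    rw [sub_mul, mul_sub, smul_mul_assoc, one_mul, mul_smul_comm, mul_assoc]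
  rw [this, map_sub, map_smul, smul_eq_mul, Function.comp_apply]
  ring

theorem continuous_exp_mul_apply_exp_smul_mul (s : ℂ) (Y : 𝔸) :
    Continuous (fun t : ℝ => Complex.exp (-s * t) * φ (NormedSpace.exp ((t : ℂ) • A) * Y)) :=
  continuous_iff_continuousAt.2 fun t => (hasDerivAt_exp_mul_apply_exp_smul_mul φ s Y t).continuousAt

omit [CompleteSpace 𝔸] in
theorem norm_exp_mul_apply_exp_smul_mul_le
    (hK : ∀ t : ℝ, 0 ≤ t → ‖NormedSpace.exp ((t : ℂ) • A)‖ ≤ K) (s : ℂ) (Y : 𝔸) {t : ℝ} (ht : 0 ≤ t) :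
    ‖Complex.exp (-s * t) * φ (NormedSpace.exp ((t : ℂ) • A) * Y)‖
      ≤ Real.exp (-s.re * t) * (‖φ‖ * (K * ‖Y‖)) := by
  rw [norm_mul, Complex.norm_exp]
  have : (-s * t).re = -s.re * t := by simp
  rw [this]
  refine mul_le_mul_of_nonneg_left ((φ.le_opNorm _).trans ?_) (Real.exp_nonneg _)
  refine mul_le_mul_of_nonneg_left ((norm_mul_le _ _).trans ?_) (norm_nonneg _)
  exact mul_le_mul_of_nonneg_right (hK t ht) (norm_nonneg _)

theorem integrableOn_mul_exp_neg_mul {b : ℝ} (hb : 0 < b) :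
    IntegrableOn (fun t : ℝ => t * Real.exp (-b * t)) (Ioi 0) := by
  have := integrableOn_rpow_mul_exp_neg_mul_rpow (p := 1) (s := 1) (b := b) (by norm_num) one_pos hb
  simpa using this

theorem tendsto_mul_exp_neg_mul {b : ℝ} (hb : 0 < b) :
    Tendsto (fun t : ℝ => t * Real.exp (-b * t)) atTop (𝓝 0) := by
  simpa using tendsto_rpow_mul_exp_neg_mul_atTop_nhds_zero 1 b hb

theorem tendsto_exp_neg_mul {b : ℝ} (hb : 0 < b) :
    Tendsto (fun t : ℝ => Real.exp (-b * t)) atTop (𝓝 0) := by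
  simpa using tendsto_rpow_mul_exp_neg_mul_atTop_nhds_zero 0 b hb

variable (hK : ∀ t : ℝ, 0 ≤ t → ‖NormedSpace.exp ((t : ℂ) • A)‖ ≤ K) {s : ℂ} (hs : 0 < s.re)
include hK hs

omit [CompleteSpace 𝔸] in
theorem tendsto_exp_mul_apply_exp_smul_mul (Y : 𝔸) :
    Tendsto (fun t : ℝ => Complex.exp (-s * t) * φ (NormedSpace.exp ((t : ℂ) • A) * Y)) atTop
      (𝓝 0) := by
  refine squeeze_zero_norm' (a := fun t => Real.exp (-s.re * t) * (‖φ‖ * (K * ‖Y‖))) ?_ ?_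
  · filter_upwards [eventually_ge_atTop 0] with t ht
    exact norm_exp_mul_apply_exp_smul_mul_le φ hK s Y ht
  · simpa using (tendsto_exp_neg_mul hs).mul_const (‖φ‖ * (K * ‖Y‖))

omit [CompleteSpace 𝔸] in
theorem tendsto_mul_exp_mul_apply_exp_smul_mul (Y : 𝔸) :
    Tendsto (fun t : ℝ => (t : ℂ) * (Complex.exp (-s * t) * φ (NormedSpace.exp ((t : ℂ) • A) * Y)))
      atTop (𝓝 0) := by
  refine squeeze_zero_norm' (a := fun t => t * Real.exp (-s.re * t) * (‖φ‖ * (K * ‖Y‖))) ?_ ?_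
  · filter_upwards [eventually_ge_atTop 0] with t ht
    rw [norm_mul, Complex.norm_real, Real.norm_of_nonneg ht, mul_assoc]
    exact mul_le_mul_of_nonneg_left (norm_exp_mul_apply_exp_smul_mul_le φ hK s Y ht) ht
  · simpa using (tendsto_mul_exp_neg_mul hs).mul_const (‖φ‖ * (K * ‖Y‖))

theorem integrableOn_exp_mul_apply_exp_smul_mul (Y : 𝔸) :
    IntegrableOn (fun t : ℝ => Complex.exp (-s * t) * φ (NormedSpace.exp ((t : ℂ) • A) * Y))
      (Ioi 0) := by
  refine Integrable.mono' ((exp_neg_integrableOn_Ioi 0 hs).mul_const (‖φ‖ * (K * ‖Y‖)))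
    (continuous_exp_mul_apply_exp_smul_mul φ s Y).aestronglyMeasurable ?_
  filter_upwards [ae_restrict_mem measurableSet_Ioi] with t ht
  exact norm_exp_mul_apply_exp_smul_mul_le φ hK s Y (le_of_lt ht)

theorem integrableOn_mul_exp_mul_apply_exp_smul_mul (Y : 𝔸) :
    IntegrableOn
      (fun t : ℝ => (t : ℂ) * (Complex.exp (-s * t) * φ (NormedSpace.exp ((t : ℂ) • A) * Y)))
      (Ioi 0) := by
  refine Integrable.mono' ((integrableOn_mul_exp_neg_mul hs).mul_const (‖φ‖ * (K * ‖Y‖)))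
    (Complex.continuous_ofReal.mul
      (continuous_exp_mul_apply_exp_smul_mul φ s Y)).aestronglyMeasurable ?_
  filter_upwards [ae_restrict_mem measurableSet_Ioi] with t ht
  rw [norm_mul, Complex.norm_real, Real.norm_of_nonneg (le_of_lt ht), mul_assoc]
  exact mul_le_mul_of_nonneg_left
    (norm_exp_mul_apply_exp_smul_mul_le φ hK s Y (le_of_lt ht)) (le_of_lt ht)

/-- The Laplace transform of `t ↦ φ (exp (t A))` is `φ` of the resolvent. -/
theorem integral_exp_mul_apply_exp_smul {R : 𝔸} (hR : (s • 1 - A) * R = 1) :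
    ∫ t in Ioi (0 : ℝ), Complex.exp (-s * t) * φ (NormedSpace.exp ((t : ℂ) • A)) = φ R := by
  have hd : ∀ t ∈ Ici (0 : ℝ), HasDerivAt
      (fun t : ℝ => -(Complex.exp (-s * t) * φ (NormedSpace.exp ((t : ℂ) • A) * R)))
      (Complex.exp (-s * t) * φ (NormedSpace.exp ((t : ℂ) • A))) t := fun t _ => by
    refine (hasDerivAt_exp_mul_apply_exp_smul_mul φ s R t (A := A)).neg.congr_deriv ?_
    rw [hR, mul_one, neg_neg]
  have := integral_Ioi_of_hasDerivAt_of_tendsto' hd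
    (by simpa using integrableOn_exp_mul_apply_exp_smul_mul φ hK hs 1)
    (tendsto_exp_mul_apply_exp_smul_mul φ hK hs R).neg
  simpa using this

/-- The Laplace transform of `t ↦ t φ (exp (t A))` is `φ` of the squared resolvent. -/
theorem integral_mul_exp_mul_apply_exp_smul {R : 𝔸} (hR : (s • 1 - A) * R = 1) :
    ∫ t in Ioi (0 : ℝ), (t : ℂ) * (Complex.exp (-s * t) * φ (NormedSpace.exp ((t : ℂ) • A)))
      = φ (R * R) := by
  have hRR : (s • 1 - A) * (R * R) = R := by rw [← mul_assoc, hR, one_mul]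
  -- Integration by parts in closed form: the unwanted `R` term from differentiating `t` cancels
  -- against the derivative of the `R * R` term.
  have hd : ∀ t ∈ Ici (0 : ℝ), HasDerivAt
      (fun t : ℝ => -((t : ℂ) * (Complex.exp (-s * t) * φ (NormedSpace.exp ((t : ℂ) • A) * R)))
        - (Complex.exp (-s * t) * φ (NormedSpace.exp ((t : ℂ) • A) * (R * R))))
      ((t : ℂ) * (Complex.exp (-s * t) * φ (NormedSpace.exp ((t : ℂ) • A)))) t := fun t _ => by
    have h1 := hasDerivAt_exp_mul_apply_exp_smul_mul φ s R t (A := A)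
    have h2 := hasDerivAt_exp_mul_apply_exp_smul_mul φ s (R * R) t (A := A)
    have h3 : HasDerivAt (fun t : ℝ => (t : ℂ)) 1 t := Complex.ofRealCLM.hasDerivAt
    refine ((h3.mul h1).neg.sub h2).congr_deriv ?_
    rw [hR, hRR, mul_one]
    ring
  have := integral_Ioi_of_hasDerivAt_of_tendsto' hd
    (by simpa using integrableOn_mul_exp_mul_apply_exp_smul_mul φ hK hs 1)
    ((tendsto_mul_exp_mul_apply_exp_smul_mul φ hK hs R).neg.sub
      (tendsto_exp_mul_apply_exp_smul_mul φ hK hs (R * R)))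
  simpa using this

/-- A bound on the semigroup gives a bound on the resolvent. -/
theorem norm_apply_resolvent_le {R : 𝔸} (hR : (s • 1 - A) * R = 1) {M : ℝ}
    (hM : ∀ t : ℝ, 0 ≤ t → ‖φ (NormedSpace.exp ((t : ℂ) • A))‖ ≤ M) :
    s.re * ‖φ R‖ ≤ M := by
  rw [← integral_exp_mul_apply_exp_smul φ hK hs hR]
  have h1 : ‖∫ t in Ioi (0 : ℝ), Complex.exp (-s * t) * φ (NormedSpace.exp ((t : ℂ) • A))‖
      ≤ ∫ t in Ioi (0 : ℝ), Real.exp (-s.re * t) * M := by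
    refine norm_integral_le_of_norm_le ((exp_neg_integrableOn_Ioi 0 hs).mul_const M) ?_
    filter_upwards [ae_restrict_mem measurableSet_Ioi] with t ht
    rw [norm_mul, Complex.norm_exp, show (-s * t).re = -s.re * t by simp]
    exact mul_le_mul_of_nonneg_left (hM t (le_of_lt ht)) (Real.exp_nonneg _)
  rw [integral_mul_const, integral_exp_mul_Ioi (by linarith) 0] at h1
  refine (mul_le_mul_of_nonneg_left h1 hs.le).trans (le_of_eq ?_)
  simp
  field_simp

end BanachAlgebra

/-! ### Fourier inversion along a vertical line -/

section LaplaceInversion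

variable {𝔸 : Type*} [NormedRing 𝔸] [NormedAlgebra ℂ 𝔸] [CompleteSpace 𝔸]

open scoped FourierTransform in
/-- Bounding the semigroup by the integral of the squared resolvent along a vertical line. -/
theorem mul_exp_mul_norm_apply_exp_smul_le {A : 𝔸} {K : ℝ} (φ : 𝔸 →L[ℂ] ℂ)
    (hK : ∀ t : ℝ, 0 ≤ t → ‖NormedSpace.exp ((t : ℂ) • A)‖ ≤ K) {ε : ℝ} (hε : 0 < ε) {R : ℝ → 𝔸}
    (hR : ∀ ξ : ℝ, (((ε : ℂ) + 2 * Real.pi * Complex.I * ξ) • 1 - A) * R ξ = 1)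
    (hc : Continuous fun ξ => φ (R ξ * R ξ)) {V : ℝ} (hV0 : 0 ≤ V)
    (hV : ∫⁻ ξ, ‖φ (R ξ * R ξ)‖ₑ ≤ ENNReal.ofReal V) {t : ℝ} (ht : 0 ≤ t) :
    t * Real.exp (-ε * t) * ‖φ (NormedSpace.exp ((t : ℂ) • A))‖ ≤ V := by
  -- Extension by zero of `t e^{-εt} φ(e^{tA})`. The factor `t` makes it continuous at `0`, as
  -- pointwise inversion requires.
  set f : ℝ → ℂ := fun t => ((max t 0 : ℝ) : ℂ) *
    (Complex.exp (-(ε : ℂ) * t) * φ (NormedSpace.exp ((t : ℂ) • A))) with hf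
  have hcont : Continuous f := by
    have := continuous_exp_mul_apply_exp_smul_mul φ (ε : ℂ) (1 : 𝔸) (A := A)
    simp only [mul_one] at this
    exact (Complex.continuous_ofReal.comp (by fun_prop)).mul this
  have hf0 : ∀ x ∉ Ioi (0 : ℝ), f x = 0 := fun x hx => by
    simp [hf, max_eq_right (not_lt.1 (mem_Ioi.not.1 hx))]
  have hint : Integrable f := by
    rw [← integrableOn_iff_integrable_of_support_subset (s := Ioi 0)
      (Function.support_subset_iff'.2 hf0)]
    refine (integrableOn_mul_exp_mul_apply_exp_smul_mul φ hK (s := (ε : ℂ)) (by simpa) 1).congr_fun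
      (fun x hx => ?_) measurableSet_Ioi
    simp [hf, max_eq_left (le_of_lt (mem_Ioi.1 hx))]
  have hF : 𝓕 f = fun ξ => φ (R ξ * R ξ) := by
    ext ξ
    rw [Real.fourier_real_eq_integral_exp_smul,
      ← integral_mul_exp_mul_apply_exp_smul φ hK (s := (ε : ℂ) + 2 * Real.pi * Complex.I * ξ)
        (by simpa) (hR ξ), ← setIntegral_eq_integral_of_forall_compl_eq_zero (s := Ioi 0)
        (fun x hx => by rw [hf0 x hx, smul_zero])]
    refine setIntegral_congr_fun measurableSet_Ioi fun x hx => ?_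
    simp only [hf, max_eq_left (le_of_lt (mem_Ioi.1 hx)), smul_eq_mul]
    rw [show -((ε : ℂ) + 2 * Real.pi * Complex.I * ξ) * x
      = ((-2 * Real.pi * x * ξ : ℝ) : ℂ) * Complex.I + -(ε : ℂ) * x by push_cast; ring,
      Complex.exp_add]
    ring
  have hFint : Integrable (𝓕 f) := by
    rw [hF]
    exact ⟨hc.aestronglyMeasurable, hV.trans_lt ENNReal.ofReal_lt_top⟩
  have hinv := congrFun (hcont.fourierInv_fourier_eq hint hFint) t
  have hnorm : ‖f t‖ ≤ V := by
    rw [← hinv, Real.fourierInv_eq']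
    refine (norm_integral_le_integral_norm _).trans ?_
    simp_rw [norm_smul, Complex.norm_exp_ofReal_mul_I, one_mul, hF]
    rw [integral_norm_eq_lintegral_enorm hc.aestronglyMeasurable]
    exact ENNReal.toReal_le_of_le_ofReal hV0 hV
  refine le_trans (le_of_eq ?_) hnorm
  simp only [hf, max_eq_left ht]
  rw [norm_mul, norm_mul, Complex.norm_real, Real.norm_of_nonneg ht, Complex.norm_exp]
  simp [mul_assoc]

end LaplaceInversion

/-! ### The Euclidean operator norm: complexification and test vectors -/

section MatrixNorm

open scoped Matrix.Norms.L2Operator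

/-- A real matrix acts separately on real and imaginary parts, whose squared norms add; conversely,
real vectors embed isometrically. -/
theorem l2_opNorm_map_ofReal {m n : ℕ} (M : Matrix (Fin m) (Fin n) ℝ) :
    ‖M.map Complex.ofReal‖ = ‖M‖ := by
  have hre : ∀ (x : Fin n → ℂ) i,
      ((M.map Complex.ofReal *ᵥ x) i).re = (M *ᵥ fun j => (x j).re) i := fun x i => by
    simp [Matrix.mulVec, dotProduct]
  have him : ∀ (x : Fin n → ℂ) i,
      ((M.map Complex.ofReal *ᵥ x) i).im = (M *ᵥ fun j => (x j).im) i := fun x i => by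
    simp [Matrix.mulVec, dotProduct]
  apply le_antisymm
  · rw [Matrix.l2_opNorm_def]
    refine ContinuousLinearMap.opNorm_le_bound _ (norm_nonneg _) fun x => ?_
    refine le_of_sq_le_sq ?_ (mul_nonneg (norm_nonneg _) (norm_nonneg _))
    have h1 := Matrix.l2_opNorm_mulVec M (WithLp.toLp 2 fun j => (x j).re)
    have h2 := Matrix.l2_opNorm_mulVec M (WithLp.toLp 2 fun j => (x j).im)
    have h1' := pow_le_pow_left₀ (norm_nonneg _) h1 2
    have h2' := pow_le_pow_left₀ (norm_nonneg _) h2 2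
    rw [mul_pow, EuclideanSpace.norm_sq_eq, EuclideanSpace.norm_sq_eq] at h1' h2'
    rw [mul_pow, EuclideanSpace.norm_sq_eq, EuclideanSpace.norm_sq_eq]
    have hx : ∑ i, ‖x i‖ ^ 2 = ∑ i, ‖(x i).re‖ ^ 2 + ∑ i, ‖(x i).im‖ ^ 2 := by
      rw [← Finset.sum_add_distrib]
      refine Finset.sum_congr rfl fun i _ => ?_
      rw [Complex.sq_norm, Complex.normSq_apply, Real.norm_eq_abs, Real.norm_eq_abs, sq_abs, sq_abs]
      ring
    rw [hx, mul_add]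
    refine le_trans (le_of_eq ?_) (add_le_add h1' h2')
    rw [← Finset.sum_add_distrib]
    refine Finset.sum_congr rfl fun i _ => ?_
    rw [Complex.sq_norm, Complex.normSq_apply, Real.norm_eq_abs, Real.norm_eq_abs, sq_abs, sq_abs,
      sq, sq]
    congr 1
    · exact congrArg₂ (· * ·) (hre x i) (hre x i)
    · exact congrArg₂ (· * ·) (him x i) (him x i)
  · rw [Matrix.l2_opNorm_def M]
    refine ContinuousLinearMap.opNorm_le_bound _ (norm_nonneg _) fun x => ?_
    have h := Matrix.l2_opNorm_mulVec (M.map Complex.ofReal) (WithLp.toLp 2 fun j => (x j : ℂ))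
    have hx : ‖(WithLp.toLp 2 fun j => (x j : ℂ) : EuclideanSpace ℂ (Fin n))‖ = ‖x‖ := by
      simp [EuclideanSpace.norm_eq]
    rw [hx] at h
    refine le_trans (le_of_eq ?_) h
    rw [EuclideanSpace.norm_eq, EuclideanSpace.norm_eq]
    congr 1
    refine Finset.sum_congr rfl fun i _ => ?_
    have : (M.map Complex.ofReal *ᵥ fun j => (x j : ℂ)) i = ((M *ᵥ x.ofLp) i : ℝ) := by
      simp [Matrix.mulVec, dotProduct]
    change ‖(M *ᵥ x.ofLp) i‖ ^ 2 = ‖(M.map Complex.ofReal *ᵥ fun j => (x j : ℂ)) i‖ ^ 2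
    rw [this, Complex.norm_real]

theorem norm_star_dotProduct_mulVec_le {m n : ℕ} (M : Matrix (Fin m) (Fin n) ℂ)
    (u : EuclideanSpace ℂ (Fin m)) (v : EuclideanSpace ℂ (Fin n)) :
    ‖star u.ofLp ⬝ᵥ (M *ᵥ v.ofLp)‖ ≤ ‖M‖ * (‖u‖ * ‖v‖) := by
  have h : star u.ofLp ⬝ᵥ (M *ᵥ v.ofLp) = inner ℂ u (WithLp.toLp 2 (M *ᵥ v.ofLp)) := by
    rw [EuclideanSpace.inner_eq_star_dotProduct, dotProduct_comm]
  rw [h]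
  refine (norm_inner_le_norm _ _).trans ?_
  refine (mul_le_mul_of_nonneg_left (Matrix.l2_opNorm_mulVec M v) (norm_nonneg u)).trans
    (le_of_eq ?_)
  ring

/-- Test with `u = M v` and cancel one factor of its norm. -/
theorem l2_opNorm_le_of_dotProduct_le {m n : ℕ} {M : Matrix (Fin m) (Fin n) ℂ} {c : ℝ} (hc : 0 ≤ c)
    (h : ∀ (u : EuclideanSpace ℂ (Fin m)) (v : EuclideanSpace ℂ (Fin n)),
      ‖star u.ofLp ⬝ᵥ (M *ᵥ v.ofLp)‖ ≤ c * (‖u‖ * ‖v‖)) : ‖M‖ ≤ c := by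
  rw [Matrix.l2_opNorm_def]
  refine ContinuousLinearMap.opNorm_le_bound _ hc fun v => ?_
  set y : EuclideanSpace ℂ (Fin m) := WithLp.toLp 2 (M *ᵥ v.ofLp) with hy
  change ‖y‖ ≤ c * ‖v‖
  have h1 := h y v
  have h2 : star y.ofLp ⬝ᵥ (M *ᵥ v.ofLp) = inner ℂ y y := by
    rw [EuclideanSpace.inner_eq_star_dotProduct, dotProduct_comm]
  rw [h2, inner_self_eq_norm_sq_to_K, norm_pow, RCLike.norm_ofReal, abs_norm] at h1
  rcases (norm_nonneg y).eq_or_lt with h0 | h0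
  · rw [← h0]; positivity
  · refine le_of_mul_le_mul_left ?_ h0
    nlinarith

theorem dotProduct_mul_mul_mulVec {l m n p : ℕ} (u : Fin l → ℂ) (C : Matrix (Fin l) (Fin m) ℂ)
    (M : Matrix (Fin m) (Fin n) ℂ) (B : Matrix (Fin n) (Fin p) ℂ) (v : Fin p → ℂ) :
    u ⬝ᵥ ((C * M * B) *ᵥ v) = (u ᵥ* C) ⬝ᵥ (M *ᵥ (B *ᵥ v)) := by
  rw [← Matrix.mulVec_mulVec, ← Matrix.mulVec_mulVec, Matrix.dotProduct_mulVec]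

end MatrixNorm

/-! ### Rationality of the resolvent and the scalar Kreiss bound -/

section Matrix

open scoped Matrix.Norms.L2Operator

variable {n : ℕ} {A : Matrix (Fin n) (Fin n) ℂ}

/-- The functional `M ↦ wᵀ M z`. -/
noncomputable def bilinFunctional (w z : Fin n → ℂ) : Matrix (Fin n) (Fin n) ℂ →L[ℂ] ℂ :=
  LinearMap.toContinuousLinearMap
    { toFun := fun M => w ⬝ᵥ (M *ᵥ z)
      map_add' := fun M N => by rw [Matrix.add_mulVec, dotProduct_add]
      map_smul' := fun c M => by rw [Matrix.smul_mulVec, dotProduct_smul, RingHom.id_apply] }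

theorem bilinFunctional_apply (w z : Fin n → ℂ) (M : Matrix (Fin n) (Fin n) ℂ) :
    bilinFunctional w z M = w ⬝ᵥ (M *ᵥ z) := rfl

theorem resolvent_eq_inv (s : ℂ) : resolvent A s = (s • (1 : Matrix (Fin n) (Fin n) ℂ) - A)⁻¹ := by
  rw [resolvent, Matrix.nonsing_inv_eq_ringInverse, Algebra.algebraMap_eq_smul_one]

theorem isUnit_smul_one_sub (hA : ∀ μ ∈ spectrum ℂ A, μ.re < 0) {s : ℂ} (hs : 0 < s.re) :
    IsUnit (s • (1 : Matrix (Fin n) (Fin n) ℂ) - A) := by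
  have : s ∉ spectrum ℂ A := fun h => by linarith [hA s h]
  rwa [spectrum.notMem_iff, Algebra.algebraMap_eq_smul_one] at this

theorem smul_one_sub_mul_resolvent (hA : ∀ μ ∈ spectrum ℂ A, μ.re < 0) {s : ℂ} (hs : 0 < s.re) :
    (s • 1 - A) * resolvent A s = 1 := by
  rw [resolvent_eq_inv]
  exact Matrix.mul_nonsing_inv _ ((Matrix.isUnit_iff_isUnit_det _).1 (isUnit_smul_one_sub hA hs))

/-- A matrix element of the resolvent as a quotient of characteristic polynomials. -/
theorem dotProduct_resolvent_mulVec_eq_div (w z : Fin n → ℂ) {s : ℂ}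
    (hs : IsUnit (s • (1 : Matrix (Fin n) (Fin n) ℂ) - A)) :
    A.charpoly.eval s ≠ 0 ∧ w ⬝ᵥ (resolvent A s *ᵥ z) =
      ((A - Matrix.vecMulVec z w).charpoly - A.charpoly).eval s / A.charpoly.eval s := by
  have hdet := (Matrix.isUnit_iff_isUnit_det _).1 hs
  have hscal : Matrix.scalar (Fin n) s = s • (1 : Matrix (Fin n) (Fin n) ℂ) := by
    ext i j; simp [Matrix.one_apply, Matrix.diagonal_apply]
  have hchar : A.charpoly.eval s = (s • (1 : Matrix (Fin n) (Fin n) ℂ) - A).det := by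
    rw [Matrix.eval_charpoly, hscal]
  have hne : A.charpoly.eval s ≠ 0 := by rw [hchar]; exact hdet.ne_zero
  refine ⟨hne, ?_⟩
  -- Matrix determinant lemma for the rank-one update `sI - (A - z wᵀ) = (sI - A) + z wᵀ`.
  have hchar' : (A - Matrix.vecMulVec z w).charpoly.eval s
      = A.charpoly.eval s * (1 + w ⬝ᵥ (resolvent A s *ᵥ z)) := by
    rw [Matrix.eval_charpoly, hscal, hchar, resolvent_eq_inv, sub_sub_eq_add_sub, add_sub_right_comm,
      Matrix.vecMulVec_eq Unit, Matrix.det_add_replicateCol_mul_replicateRow hdet]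
    congr 1
    rw [Matrix.det_unique, Matrix.add_apply, Matrix.one_apply_eq, Matrix.dotProduct_mulVec]
    rfl
  rw [eval_sub, hchar', eq_div_iff hne]
  ring

/-- The scalar form of the Kreiss bound. -/
theorem norm_dotProduct_exp_mulVec_le (hA : ∀ μ ∈ spectrum ℂ A, μ.re < 0) (w z : Fin n → ℂ) {κ : ℝ}
    (hκ : ∀ s : ℂ, 0 < s.re → s.re * ‖w ⬝ᵥ (resolvent A s *ᵥ z)‖ ≤ κ) {t : ℝ} (ht : 0 < t) :
    ‖w ⬝ᵥ (NormedSpace.exp ((t : ℂ) • A) *ᵥ z)‖ ≤ Real.exp 1 * n * κ := by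
  obtain ⟨K, hK⟩ := exists_norm_exp_smul_le_of_spectrum hA
  set φ := bilinFunctional w z with hφ
  have hκ0 : 0 ≤ κ := le_trans (mul_nonneg (by simp) (norm_nonneg _)) (hκ 1 (by simp))
  -- This abscissa makes `e^{-εt} = e⁻¹`, the origin of the constant `e`, and makes the bound `κ/ε =
  -- tκ` cancel the factor `t` from the inversion.
  set ε : ℝ := t⁻¹ with hε
  have hε0 : 0 < ε := inv_pos.2 ht
  set σ : ℝ → ℂ := fun ξ => (ε : ℂ) + 2 * Real.pi * Complex.I * ξ with hσ
  have hσre : ∀ ξ, (σ ξ).re = ε := fun ξ => by simp [hσ]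
  have hσpos : ∀ ξ, 0 < (σ ξ).re := fun ξ => by rw [hσre]; exact hε0
  set q : ℝ → ℂ := fun ξ => φ (resolvent A (σ ξ)) with hq
  have hres : ∀ ξ, HasDerivAt (fun ξ => resolvent A (σ ξ))
      ((2 * Real.pi * Complex.I) • -(resolvent A (σ ξ)) ^ 2) ξ := by
    intro ξ
    have h1 : HasDerivAt σ (2 * Real.pi * Complex.I) ξ := by
      have h2 : HasDerivAt (fun ξ : ℝ => (ξ : ℂ)) 1 ξ := Complex.ofRealCLM.hasDerivAt
      exact ((h2.const_mul (2 * Real.pi * Complex.I)).const_add (ε : ℂ)).congr_deriv (mul_one _)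
    have hmem : σ ξ ∈ resolventSet ℂ A := by
      rw [spectrum.mem_resolventSet_iff, Algebra.algebraMap_eq_smul_one]
      exact isUnit_smul_one_sub hA (hσpos ξ)
    exact (spectrum.hasDerivAt_resolvent_const_left hmem).scomp ξ h1
  have hqd : ∀ ξ, HasDerivAt q
      (-(2 * Real.pi * Complex.I) * φ (resolvent A (σ ξ) * resolvent A (σ ξ))) ξ := by
    intro ξ
    refine ((φ.restrictScalars ℝ).hasFDerivAt.comp_hasDerivAt ξ (hres ξ)).congr_deriv ?_
    rw [ContinuousLinearMap.coe_restrictScalars', map_smul, map_neg, sq, smul_eq_mul]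
    ring
  have hRc : Continuous fun ξ => resolvent A (σ ξ) :=
    continuous_iff_continuousAt.2 fun ξ => (hres ξ).continuousAt
  have hM : ∀ ξ, ‖q ξ‖ ≤ t * κ := by
    intro ξ
    have := hκ (σ ξ) (hσpos ξ)
    rw [hσre, hε, inv_mul_le_iff₀ ht] at this
    exact this
  -- The vertical line is an affine function of `ξ`, so substituting it keeps the degrees at most
  -- `n`.
  set L : ℂ[X] := C (ε : ℂ) + C (2 * Real.pi * Complex.I) * X with hL
  have hLev : ∀ ξ : ℝ, L.eval (ξ : ℂ) = σ ξ := fun ξ => by simp [hL, hσ]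
  have hLdeg : L.natDegree ≤ 1 := by
    rw [hL, add_comm]; exact natDegree_linear_le
  have hcomp : ∀ p : ℂ[X], p.natDegree ≤ n → (p.comp L).natDegree ≤ n := fun p hp => by
    rw [natDegree_comp]
    exact (Nat.mul_le_mul hp hLdeg).trans_eq (mul_one n)
  have hcd : ∀ M : Matrix (Fin n) (Fin n) ℂ, M.charpoly.natDegree ≤ n := fun M => by
    rw [Matrix.charpoly_natDegree_eq_dim, Fintype.card_fin]
  have hrat := fun ξ => dotProduct_resolvent_mulVec_eq_div w z (isUnit_smul_one_sub hA (hσpos ξ))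
  have hint : ∫⁻ ξ, ‖-(2 * Real.pi * Complex.I) * φ (resolvent A (σ ξ) * resolvent A (σ ξ))‖ₑ
      ≤ ENNReal.ofReal (2 * Real.pi * n * (t * κ)) := by
    refine lintegral_enorm_deriv_le_of_sum_le hqd fun s a b hab hd =>
      sum_norm_sub_le_of_rational
        (P := ((A - Matrix.vecMulVec z w).charpoly - A.charpoly).comp L) (Q := A.charpoly.comp L)
        (hcomp _ ((natDegree_sub_le _ _).trans (max_le (hcd _) (hcd _)))) (hcomp _ (hcd _))
        (fun ξ => ?_) (fun ξ => ?_) hM s a b hab hd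
    · rw [eval_comp, hLev]; exact (hrat ξ).1
    · rw [eval_comp, eval_comp, hLev]; exact (hrat ξ).2
  -- The factor `2π` removed here is the speed of the parametrization `σ`.
  have hV : ∫⁻ ξ, ‖φ (resolvent A (σ ξ) * resolvent A (σ ξ))‖ₑ ≤ ENNReal.ofReal (n * (t * κ)) := by
    have h2π : ‖-(2 * Real.pi * Complex.I : ℂ)‖ₑ = ENNReal.ofReal (2 * Real.pi) := by
      rw [← ofReal_norm]
      simp [abs_of_pos Real.pi_pos]
    simp_rw [enorm_mul, h2π] at hint
    rw [lintegral_const_mul' _ _ ENNReal.ofReal_ne_top, mul_assoc (2 * Real.pi),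
      ENNReal.ofReal_mul (p := 2 * Real.pi) (by positivity)] at hint
    exact (ENNReal.mul_le_mul_iff_right (by simpa using Real.pi_pos) ENNReal.ofReal_ne_top).1 hint
  have hfin := mul_exp_mul_norm_apply_exp_smul_le φ hK hε0
    (fun ξ => smul_one_sub_mul_resolvent hA (hσpos ξ))
    (φ.continuous.comp (hRc.mul hRc)) (by positivity) hV ht.le
  rw [hε, neg_mul, inv_mul_cancel₀ ht.ne', hφ, bilinFunctional_apply, Real.exp_neg] at hfin
  have he := Real.exp_pos 1
  have h3 : t * ‖w ⬝ᵥ (NormedSpace.exp ((t : ℂ) • A) *ᵥ z)‖ ≤ t * (Real.exp 1 * n * κ) := by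
    calc _ = Real.exp 1 * (t * (Real.exp 1)⁻¹ * ‖w ⬝ᵥ (NormedSpace.exp ((t : ℂ) • A) *ᵥ z)‖) := by
          field_simp
      _ ≤ Real.exp 1 * (n * (t * κ)) := mul_le_mul_of_nonneg_left hfin he.le
      _ = _ := by ring
  exact le_of_mul_le_mul_left h3 ht

end Matrix

/-! ### The two inequalities for the system -/

section System

open scoped Matrix.Norms.L2Operator

variable {n m p : ℕ} (A : Matrix (Fin n) (Fin n) ℝ) (B : Matrix (Fin n) (Fin m) ℝ)
  (C : Matrix (Fin p) (Fin n) ℝ)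

theorem map_ofReal_exp_smul (t : ℝ) :
    (NormedSpace.exp (t • A)).map Complex.ofReal
      = NormedSpace.exp ((t : ℂ) • A.map Complex.ofReal) := by
  let _ : NormedAlgebra ℚ (Matrix (Fin n) (Fin n) ℝ) :=
    NormedAlgebra.restrictScalars ℚ ℝ (Matrix (Fin n) (Fin n) ℝ)
  have h := NormedSpace.map_exp (Complex.ofRealHom.mapMatrix (m := Fin n))
    (by exact continuous_id.matrix_map Complex.continuous_ofReal) (t • A)
  have h2 : Complex.ofRealHom.mapMatrix (t • A) = (t : ℂ) • A.map Complex.ofReal := by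
    ext i j; simp
  rw [h2] at h
  exact h

theorem maxSingularValue_impulseResponse (t : ℝ) :
    maxSingularValue (impulseResponse A B C t) = ‖C.map Complex.ofReal *
      NormedSpace.exp ((t : ℂ) • A.map Complex.ofReal) * B.map Complex.ofReal‖ := by
  rw [maxSingularValue_eq_l2_opNorm, ← l2_opNorm_map_ofReal, impulseResponse,
    ← map_ofReal_exp_smul]
  congr 1
  have hmul : ∀ {a b c : ℕ} (M : Matrix (Fin a) (Fin b) ℝ) (N : Matrix (Fin b) (Fin c) ℝ),
      (M * N).map Complex.ofReal = M.map Complex.ofReal * N.map Complex.ofReal := fun M N =>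
    Matrix.map_mul (f := Complex.ofRealHom)
  rw [hmul, hmul]

theorem maxSingularValue_transferFunction (s : ℂ) :
    maxSingularValue (transferFunction A B C s) = ‖C.map Complex.ofReal *
      resolvent (A.map Complex.ofReal) s * B.map Complex.ofReal‖ := by
  rw [maxSingularValue_eq_l2_opNorm, transferFunction, resolvent_eq_inv]

variable {A}

theorem bddAbove_transientValues (hA : IsStable A) : BddAbove (transientValues A B C) := by
  obtain ⟨K, hK⟩ := exists_norm_exp_smul_le_of_spectrum hA
  refine ⟨‖C.map Complex.ofReal‖ * K * ‖B.map Complex.ofReal‖, ?_⟩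
  rintro _ ⟨t, ht, rfl⟩
  simp only [maxSingularValue_impulseResponse]
  refine (Matrix.l2_opNorm_mul _ _).trans (mul_le_mul_of_nonneg_right ?_ (norm_nonneg _))
  exact (Matrix.l2_opNorm_mul _ _).trans (mul_le_mul_of_nonneg_left (hK t ht) (norm_nonneg _))

theorem transientValues_nonempty : (transientValues A B C).Nonempty := ⟨_, 0, le_refl (0 : ℝ), rfl⟩

theorem kreissValues_nonempty : (kreissValues A B C).Nonempty :=
  ⟨_, 1, by simp, rfl⟩

/-- With `C` and `B` absorbed into the test vectors, this is the scalar Laplace bound, whose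
constant scales with `‖u‖ * ‖v‖`. -/
theorem le_transientPeak_of_mem_kreissValues (hA : IsStable A) {x : ℝ}
    (hx : x ∈ kreissValues A B C) : x ≤ transientPeak A B C := by
  obtain ⟨s, hs, rfl⟩ := hx
  have hs : 0 < s.re := hs
  obtain ⟨K, hK⟩ := exists_norm_exp_smul_le_of_spectrum hA
  have hpeak : ∀ t : ℝ, 0 ≤ t → ‖C.map Complex.ofReal *
      NormedSpace.exp ((t : ℂ) • A.map Complex.ofReal) * B.map Complex.ofReal‖
        ≤ transientPeak A B C := fun t ht => by
    rw [← maxSingularValue_impulseResponse]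
    exact le_csSup (bddAbove_transientValues B C hA) ⟨t, ht, rfl⟩
  have hpeak0 : 0 ≤ transientPeak A B C := (norm_nonneg _).trans (hpeak 0 le_rfl)
  simp only [maxSingularValue_transferFunction]
  rw [← le_div_iff₀' hs]
  refine l2_opNorm_le_of_dotProduct_le (div_nonneg hpeak0 hs.le) fun u v => ?_
  rw [div_mul_eq_mul_div, le_div_iff₀' hs, dotProduct_mul_mul_mulVec, ← bilinFunctional_apply]
  refine norm_apply_resolvent_le _ hK hs (smul_one_sub_mul_resolvent hA hs) fun t ht => ?_
  rw [bilinFunctional_apply, ← dotProduct_mul_mul_mulVec]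
  exact (norm_star_dotProduct_mulVec_le _ u v).trans
    (mul_le_mul_of_nonneg_right (hpeak t ht) (by positivity))

theorem bddAbove_kreissValues (hA : IsStable A) : BddAbove (kreissValues A B C) :=
  ⟨_, fun _ hx => le_transientPeak_of_mem_kreissValues B C hA hx⟩

theorem maxSingularValue_impulseResponse_le (hA : IsStable A) {t : ℝ} (ht : 0 ≤ t) :
    maxSingularValue (impulseResponse A B C t) ≤ Real.exp 1 * n * kreissNorm A B C := by
  have hres : ∀ s : ℂ, 0 < s.re → s.re * ‖C.map Complex.ofReal *
      resolvent (A.map Complex.ofReal) s * B.map Complex.ofReal‖ ≤ kreissNorm A B C := fun s hs => by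
    rw [← maxSingularValue_transferFunction]
    exact le_csSup (bddAbove_kreissValues B C hA) ⟨s, hs, rfl⟩
  have hk0 : 0 ≤ kreissNorm A B C :=
    le_trans (mul_nonneg (by simp) (norm_nonneg _)) (hres 1 (by simp))
  have hpos : ∀ t : ℝ, 0 < t → maxSingularValue (impulseResponse A B C t)
      ≤ Real.exp 1 * n * kreissNorm A B C := by
    intro t ht
    rw [maxSingularValue_impulseResponse]
    refine l2_opNorm_le_of_dotProduct_le (by positivity) fun u v => ?_
    rw [dotProduct_mul_mul_mulVec, mul_assoc _ (kreissNorm A B C)]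
    refine norm_dotProduct_exp_mulVec_le hA _ _ (fun s hs => ?_) ht
    rw [← dotProduct_mul_mul_mulVec]
    refine (mul_le_mul_of_nonneg_left (norm_star_dotProduct_mulVec_le _ u v) hs.le).trans ?_
    rw [← mul_assoc]
    exact mul_le_mul_of_nonneg_right (hres s hs) (by positivity)
  have hcont : Continuous fun t : ℝ => maxSingularValue (impulseResponse A B C t) := by
    have hexp : Continuous fun t : ℝ => NormedSpace.exp ((t : ℂ) • A.map Complex.ofReal) :=
      (differentiable_exp_smul_const ℂ (A.map Complex.ofReal)).continuous.comp
        Complex.continuous_ofReal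
    simp_rw [maxSingularValue_impulseResponse]
    exact ((continuous_const.matrix_mul hexp).matrix_mul continuous_const).norm
  -- The choice `ε = 1/t` excludes `t = 0`, which is reached as a limit from the right.
  rcases ht.eq_or_lt with rfl | ht
  · refine le_of_tendsto (hcont.continuousWithinAt (s := Ioi 0) (x := 0)) ?_
    filter_upwards [self_mem_nhdsWithin] with t ht
    exact hpos t ht
  · exact hpos t ht

end System

end KreissSystem

theorem theorem3p4 {n m p : ℕ} (A : Matrix (Fin n) (Fin n) ℝ) (B : Matrix (Fin n) (Fin m) ℝ)
    (C : Matrix (Fin p) (Fin n) ℝ) (hA : KreissSystem.IsStable A) :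
    BddAbove (KreissSystem.kreissValues A B C) ∧
    BddAbove (KreissSystem.transientValues A B C) ∧
    KreissSystem.kreissNorm A B C ≤ KreissSystem.transientPeak A B C ∧
    KreissSystem.transientPeak A B C ≤ Real.exp 1 * n * KreissSystem.kreissNorm A B C := by
  refine ⟨KreissSystem.bddAbove_kreissValues B C hA, KreissSystem.bddAbove_transientValues B C hA,
    csSup_le (KreissSystem.kreissValues_nonempty B C) fun x hx =>
      KreissSystem.le_transientPeak_of_mem_kreissValues B C hA hx,
    csSup_le (KreissSystem.transientValues_nonempty B C) ?_⟩
  rintro _ ⟨t, ht, rfl⟩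
  exact KreissSystem.maxSingularValue_impulseResponse_le B C hA ht
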